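/- Let $G$ be a connected (finite-dimensional, real) Lie group equipped with a left-invariant Riemannian metric, and let $d_G$ be the associated Riemannian distance. Then the capacity dimension of the metric space $(G,d_G)$ is at most the dimension of the manifold $G$: $$\operatorname{cdim}(G,d_G)\le \dim(G).$$ Here, for a metric space $(X,d)$ and an integer $n\ge 0$, $\operatorname{cdim}(X,d)\le n$ means that there are constants $C>0$ and $\delta>0$ such that for every $s$ with $0<s<\delta$ the space $X$ is a union of $n+1$ subsets $U_0,\dots,U_n$ such that every $s$-scale connected component of every $U_i$ has diameter at most $C\cdot s$. Two points $x,y\in U_i$ lie in the same $s$-scale connected component of $U_i$ if there is a finite sequence $x=x_0,x_1,\dots,x_m=y$ of points of $U_i$ with $d(x_j,x_{j+1})<s$ for all $0\le j<m$. -/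

import Mathlib

open scoped Manifold ContDiff Topology Bundle

/-- There is an `s`-scale chain from `x` to `y` inside `S`: finitely many points of `S`, starting
at `x` and ending at `y`, with consecutive points at distance less than `s`. -/
def ScaleChain {X : Type*} [MetricSpace X] (s : ℝ) (S : Set X) (x y : X) : Prop :=
  ∃ (m : ℕ) (c : ℕ → X), c 0 = x ∧ c m = y ∧ (∀ i ≤ m, c i ∈ S) ∧
    ∀ i < m, dist (c i) (c (i + 1)) < s

/-- The `s`-scale connected component in `S` of a point `x` of `S`. -/
def scaleComponent {X : Type*} [MetricSpace X] (s : ℝ) (S : Set X) (x : X) : Set X :=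
  {y | ScaleChain s S x y}

/-- `X` is a union of `n + 1` sets (indexed by `0, …, n`) all of whose `s`-scale connected
components have diameter at most `r`. -/
def HasScaleCover (X : Type*) [MetricSpace X] (n : ℕ) (s r : ℝ) : Prop :=
  ∃ U : Fin (n + 1) → Set X, (⋃ i, U i) = Set.univ ∧
    ∀ i, ∀ x ∈ U i, Metric.ediam (scaleComponent s (U i) x) ≤ ENNReal.ofReal r

/-- The capacity dimension of `X` is at most `n`: for some constant `C > 0`, the function
`s ↦ C * s` is an `n`-dimensional control function of `X` at all sufficiently small scales `s`. -/
def CapDimLE (X : Type*) [MetricSpace X] (n : ℕ) : Prop :=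
  ∃ C : ℝ, 0 < C ∧ ∃ δ : ℝ, 0 < δ ∧ ∀ s : ℝ, 0 < s → s < δ → HasScaleCover X n s (C * s)

/-- A Riemannian metric on (the tangent bundle of) a Lie group is left-invariant: the differential
of every left translation `x ↦ g * x` preserves the inner products of tangent vectors. -/
def IsLeftInvariantMetric {E : Type*} [NormedAddCommGroup E] [NormedSpace ℝ E]
    {H : Type*} [TopologicalSpace H] (I : ModelWithCorners ℝ E H)
    (G : Type*) [Group G] [TopologicalSpace G] [ChartedSpace H G]
    [Bundle.RiemannianBundle (fun x : G => TangentSpace I x)] : Prop :=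
  ∀ (g x : G) (v w : TangentSpace I x),
    inner ℝ (mfderiv I I (fun y : G => g * y) x v : TangentSpace I (g * x))
      (mfderiv I I (fun y : G => g * y) x w : TangentSpace I (g * x)) = inner ℝ v w

/-! Write n for the dimension of G. In ℝⁿ, n + 1 colour classes avoiding prescribed distances to a
scaled integer lattice have components of size linear in the scale (`scaleCovered_pi`). This
transfers through bi-Lipschitz maps (`ScaleCovered.preimage`). A chart at 1 is bi-Lipschitz on a
small ball, and left translations are isometries, so all balls of that radius embed in ℝⁿ with the
same constants.

To globalize, uniform packing bounds in these balls cover G by finitely many families of small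
balls, each family with well separated members (`exists_separated_ball_cover`). Within one family no
small-scale chain jumps between balls, so the local estimate passes to its union. Finite unions
preserve capacity dimension at most n (`CapDimLEOn.union`), so the number of families affects only
the constants. -/

/-- Two points of `S` at distance less than `s`. -/
def ScaleStep {X : Type*} [MetricSpace X] (s : ℝ) (S : Set X) (x y : X) : Prop :=
  x ∈ S ∧ y ∈ S ∧ dist x y < s

/-- Points of `S` joined by an `s`-scale chain in `S` are at distance at most `r`. -/
def ScaleBounded {X : Type*} [MetricSpace X] (S : Set X) (s r : ℝ) : Prop :=
  ∀ x ∈ S, ∀ y, Relation.ReflTransGen (ScaleStep s S) x y → dist x y ≤ r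

/-- `A` is covered by `n + 1` sets whose `s`-scale components are bounded by `r`. -/
def ScaleCovered {X : Type*} [MetricSpace X] (n : ℕ) (A : Set X) (s r : ℝ) : Prop :=
  ∃ U : Fin (n + 1) → Set X, (A ⊆ ⋃ i, U i) ∧ ∀ i, ScaleBounded (U i) s r

/-- A version of `CapDimLE` for subsets of a metric space. -/
def CapDimLEOn {X : Type*} [MetricSpace X] (n : ℕ) (A : Set X) : Prop :=
  ∃ C : ℝ, 0 < C ∧ ∃ δ : ℝ, 0 < δ ∧ ∀ s : ℝ, 0 < s → s < δ → ScaleCovered n A s (C * s)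

/-! ### Calculus of scale components: unions and bi-Lipschitz pullback. -/

section ScaleLemmas

variable {X : Type*} [MetricSpace X]

theorem ScaleChain.reflTransGen {s : ℝ} {S : Set X} {x y : X} (h : ScaleChain s S x y) :
    Relation.ReflTransGen (ScaleStep s S) x y := by
  obtain ⟨m, c, rfl, rfl, hS, hd⟩ := h
  have key : ∀ k ≤ m, Relation.ReflTransGen (ScaleStep s S) (c 0) (c k) := by
    intro k
    induction k with
    | zero => exact fun _ => .refl
    | succ k ih =>
      exact fun hk => (ih (by omega)).tail ⟨hS _ (by omega), hS _ hk, hd _ (by omega)⟩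
  exact key m le_rfl

theorem ScaleBounded.mono {S T : Set X} {s r : ℝ} (h : ScaleBounded T s r) (hST : S ⊆ T) :
    ScaleBounded S s r := fun x hx y hxy =>
  h x (hST hx) y (Relation.ReflTransGen.mono
    (fun _ _ hab => ⟨hST hab.1, hST hab.2.1, hab.2.2⟩) _ _ hxy)

theorem ScaleCovered.hasScaleCover {n : ℕ} {s r : ℝ}
    (h : ScaleCovered n (Set.univ : Set X) s r) : HasScaleCover X n s (2 * r) := by
  obtain ⟨U, hU, hb⟩ := h
  refine ⟨U, Set.univ_subset_iff.1 hU, fun i x hx => Metric.ediam_le fun y hy z hz => ?_⟩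
  rw [edist_dist]
  refine ENNReal.ofReal_le_ofReal ?_
  have h1 := hb i x hx y (ScaleChain.reflTransGen hy)
  have h2 := hb i x hx z (ScaleChain.reflTransGen hz)
  have h3 := dist_triangle_left y z x
  linarith

theorem CapDimLEOn.capDimLE {n : ℕ} (h : CapDimLEOn n (Set.univ : Set X)) : CapDimLE X n := by
  obtain ⟨C, hC, δ, hδ, h⟩ := h
  refine ⟨2 * C, by positivity, δ, hδ, fun s hs hsδ => ?_⟩
  rw [mul_assoc]
  exact (h s hs hsδ).hasScaleCover

/-- The union of two sets, the second of which is bounded at a scale that exceeds the bound on the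
first one. -/
theorem ScaleBounded.union {S T : Set X} {s R D : ℝ} (hs : 0 < s) (hR : 0 ≤ R) (hD : 0 ≤ D)
    (hS : ScaleBounded S s R) (hT : ScaleBounded T (R + 2 * s) D) :
    ScaleBounded (S ∪ T) s (D + 2 * R + 2 * s) := by
  intro x hx y hxy
  -- Between visits to T the chain moves inside S by at most R, plus two steps below s, so its
  -- points in T form an (R + 2s)-chain from b to b'. The initial and final excursions cost R + s
  -- each.
  have key : (x ∈ S ∧ y ∈ S ∧ Relation.ReflTransGen (ScaleStep s S) x y) ∨
      ∃ b ∈ T, ∃ b' ∈ T, dist x b < R + s ∧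
        Relation.ReflTransGen (ScaleStep (R + 2 * s) T) b b' ∧
        (y = b' ∨ ∃ a ∈ S, y ∈ S ∧ dist b' a < s ∧ Relation.ReflTransGen (ScaleStep s S) a y) := by
    induction hxy with
    | refl =>
      rcases hx with hx | hx
      · exact .inl ⟨hx, hx, .refl⟩
      · exact .inr ⟨x, hx, x, hx, by simp; positivity, .refl, .inl rfl⟩
    | @tail y z _ hyz ih =>
      obtain ⟨-, hz, hd⟩ := hyz
      rcases ih with ⟨hx, hy, h⟩ | ⟨b, hb, b', hb', hxb, hbb, rfl | ⟨a, ha, hy, hba, hay⟩⟩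
      · rcases hz with hz | hz
        · exact .inl ⟨hx, hz, h.tail ⟨hy, hz, hd⟩⟩
        · refine .inr ⟨z, hz, z, hz, ?_, .refl, .inl rfl⟩
          linarith [hS x hx y h, dist_triangle x y z]
      · rcases hz with hz | hz
        · exact .inr ⟨b, hb, y, hb', hxb, hbb, .inr ⟨z, hz, hz, hd, .refl⟩⟩
        · exact .inr ⟨b, hb, z, hz, hxb, hbb.tail ⟨hb', hz, by linarith⟩, .inl rfl⟩
      · rcases hz with hz | hz
        · exact .inr ⟨b, hb, b', hb', hxb, hbb, .inr ⟨a, ha, hz, hba, hay.tail ⟨hy, hz, hd⟩⟩⟩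
        · refine .inr ⟨b, hb, z, hz, hxb, hbb.tail ⟨hb', hz, ?_⟩, .inl rfl⟩
          linarith [hS a ha y hay, dist_triangle b' a z, dist_triangle a y z]
  rcases key with ⟨hx, _, h⟩ | ⟨b, hb, b', hb', hxb, hbb, rfl | ⟨a, ha, hy, hba, hay⟩⟩
  · linarith [hS x hx y h]
  · linarith [hT b hb y hbb, dist_triangle x b y]
  · linarith [hT b hb b' hbb, dist_triangle x b y, dist_triangle b b' y, dist_triangle b' a y,
      hS a ha y hay]

theorem ScaleCovered.union {n : ℕ} {A B : Set X} {s R D : ℝ} (hs : 0 < s) (hR : 0 ≤ R)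
    (hD : 0 ≤ D) (hA : ScaleCovered n A s R) (hB : ScaleCovered n B (R + 2 * s) D) :
    ScaleCovered n (A ∪ B) s (D + 2 * R + 2 * s) := by
  obtain ⟨U, hU, hUb⟩ := hA
  obtain ⟨V, hV, hVb⟩ := hB
  refine ⟨fun i => U i ∪ V i, ?_, fun i => (hUb i).union hs hR hD (hVb i)⟩
  rw [Set.iUnion_union_distrib]
  exact Set.union_subset_union hU hV

/-- Using B at the scale Cs + 2s, still linear in s, keeps the final bound linear without adding
colours. -/
theorem CapDimLEOn.union {n : ℕ} {A B : Set X} (hA : CapDimLEOn n A) (hB : CapDimLEOn n B) :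
    CapDimLEOn n (A ∪ B) := by
  obtain ⟨C, hC, δ, hδ, hA⟩ := hA
  obtain ⟨C', hC', δ', hδ', hB⟩ := hB
  refine ⟨C' * (C + 2) + 2 * C + 2, by positivity, min δ (δ' / (C + 2)), by positivity,
    fun s hs hsδ => ?_⟩
  obtain ⟨h1, h2⟩ := lt_min_iff.1 hsδ
  rw [lt_div_iff₀ (by positivity)] at h2
  have := (hA s hs h1).union (D := C' * (C * s + 2 * s)) hs (by positivity) (by positivity)
    (hB (C * s + 2 * s) (by positivity) (by linarith))
  convert this using 1
  ring

theorem capDimLEOn_empty (n : ℕ) : CapDimLEOn n (∅ : Set X) :=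
  ⟨1, one_pos, 1, one_pos, fun _ _ _ => ⟨fun _ => ∅, by simp, fun _ _ hx => hx.elim⟩⟩

theorem capDimLEOn_iUnion_lt {n : ℕ} {A : ℕ → Set X} (hA : ∀ k, CapDimLEOn n (A k)) (N : ℕ) :
    CapDimLEOn n (⋃ k < N, A k) := by
  induction N with
  | zero => simpa using capDimLEOn_empty n
  | succ N ih =>
    rw [Set.biUnion_lt_succ]
    exact ih.union (hA N)

/-- Bounded sets concentrated near the points of a separated set have a bounded union. -/
theorem ScaleBounded.iUnion_of_separated {Z : Set X} {ρ s r : ℝ} (hs : s ≤ ρ)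
    (hZ : ∀ a ∈ Z, ∀ b ∈ Z, dist a b < 3 * ρ → a = b) {W : X → Set X}
    (hW : ∀ a ∈ Z, W a ⊆ Metric.ball a ρ) (hb : ∀ a ∈ Z, ScaleBounded (W a) s r) :
    ScaleBounded (⋃ a ∈ Z, W a) s r := by
  intro x hx y hxy
  simp only [Set.mem_iUnion, exists_prop] at hx
  obtain ⟨a, ha, hx⟩ := hx
  have key : y ∈ W a ∧ Relation.ReflTransGen (ScaleStep s (W a)) x y := by
    induction hxy with
    | refl => exact ⟨hx, .refl⟩
    | @tail y z _ hyz ih =>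
      obtain ⟨-, hz, hd⟩ := hyz
      simp only [Set.mem_iUnion, exists_prop] at hz
      obtain ⟨b, hbZ, hz⟩ := hz
      have h1 := hW a ha ih.1
      have h2 := hW b hbZ hz
      rw [Metric.mem_ball] at h1 h2
      -- A jump between two balls would give dist a b < ρ + s + ρ ≤ 3ρ.
      obtain rfl : a = b := hZ a ha b hbZ (by
        linarith [dist_triangle_left a b y, dist_triangle y z b])
      exact ⟨hz, ih.2.tail ⟨ih.1, hz, hd⟩⟩
  exact hb a ha x hx y key.2

theorem capDimLEOn_iUnion_ball {n : ℕ} {Z : Set X} {ρ C δ : ℝ} (hρ : 0 < ρ) (hC : 0 < C)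
    (hδ : 0 < δ) (hZ : ∀ a ∈ Z, ∀ b ∈ Z, dist a b < 3 * ρ → a = b)
    (h : ∀ a : X, ∀ s, 0 < s → s < δ → ScaleCovered n (Metric.ball a ρ) s (C * s)) :
    CapDimLEOn n (⋃ a ∈ Z, Metric.ball a ρ) := by
  refine ⟨C, hC, min δ ρ, by positivity, fun s hs hsδ => ?_⟩
  obtain ⟨h1, h2⟩ := lt_min_iff.1 hsδ
  choose U hU hb using fun a => h a s hs h1
  refine ⟨fun i => ⋃ a ∈ Z, (U a i ∩ Metric.ball a ρ), ?_, fun i =>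
    ScaleBounded.iUnion_of_separated h2.le hZ (fun a _ => Set.inter_subset_right)
      fun a _ => (hb a i).mono Set.inter_subset_left⟩
  intro x hx
  simp only [Set.mem_iUnion, exists_prop] at hx ⊢
  obtain ⟨a, ha, hx⟩ := hx
  obtain ⟨i, hi⟩ := Set.mem_iUnion.1 (hU a hx)
  exact ⟨i, a, ha, hi, hx⟩

theorem ScaleBounded.preimage {Y : Type*} [MetricSpace Y] {A : Set X} {V : Set Y} {f : X → Y}
    {K s r : ℝ} (hK : 0 < K) (hf : ∀ x ∈ A, ∀ y ∈ A, dist (f x) (f y) ≤ K * dist x y)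
    (hf' : ∀ x ∈ A, ∀ y ∈ A, dist x y ≤ K * dist (f x) (f y))
    (hV : ScaleBounded V (K * s) r) : ScaleBounded (A ∩ f ⁻¹' V) s (K * r) := by
  intro x hx y hxy
  have key : y ∈ A ∧ Relation.ReflTransGen (ScaleStep (K * s) V) (f x) (f y) := by
    induction hxy with
    | refl => exact ⟨hx.1, .refl⟩
    | tail _ hyz ih =>
      obtain ⟨hy, hz, hd⟩ := hyz
      exact ⟨hz.1, ih.2.tail ⟨hy.2, hz.2, (hf _ hy.1 _ hz.1).trans_lt (by gcongr)⟩⟩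
  exact (hf' x hx.1 y key.1).trans (by gcongr; exact hV _ hx.2 _ key.2)

theorem ScaleCovered.preimage {Y : Type*} [MetricSpace Y] {n : ℕ} {A : Set X} {f : X → Y}
    {K s r : ℝ} (hK : 0 < K) (hf : ∀ x ∈ A, ∀ y ∈ A, dist (f x) (f y) ≤ K * dist x y)
    (hf' : ∀ x ∈ A, ∀ y ∈ A, dist x y ≤ K * dist (f x) (f y))
    (hV : ScaleCovered n (Set.univ : Set Y) (K * s) r) : ScaleCovered n A s (K * r) := by
  obtain ⟨V, hV, hb⟩ := hV
  refine ⟨fun i => A ∩ f ⁻¹' V i, fun x hx => ?_, fun i => (hb i).preimage hK hf hf'⟩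
  obtain ⟨i, hi⟩ := Set.mem_iUnion.1 (hV (Set.mem_univ (f x)))
  exact Set.mem_iUnion.2 ⟨i, hx, hi⟩

end ScaleLemmas

/-! ### Coloured covers and packing bounds in ℝⁿ. -/

section Euclidean

/-- Avoiding a range of distances to the integers, small steps neither change the nearest integer
of points close to the integers nor the integer part of the other points. -/
theorem round_floor_step {m j : ℕ} (hjm : j < m) {u v : ℝ} (huv : |u - v| * (2 * m) < 1)
    (hv : ⌊2 * m * |v - round v|⌋₊ ≠ j) :
    (2 * m * |u - round u| < j → 2 * m * |v - round v| < j ∧ round u = round v) ∧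
    ((j : ℝ) + 1 ≤ 2 * m * |u - round u| →
      (j : ℝ) + 1 ≤ 2 * m * |v - round v| ∧ ⌊u⌋ = ⌊v⌋) := by
  have hm : (0 : ℝ) < m := by exact_mod_cast (Nat.zero_le j).trans_lt hjm
  have hjm' : (j : ℝ) + 1 ≤ m := by exact_mod_cast hjm
  have hv' : 2 * m * |v - round v| < j ∨ (j : ℝ) + 1 ≤ 2 * m * |v - round v| := by
    by_contra! h
    exact hv ((Nat.floor_eq_iff (by positivity)).2 h)
  have hlip : |(|u - round u| - |v - round v|)| ≤ |u - v| := by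
    have h1 := round_le u (round v)
    have h2 := round_le v (round u)
    have h3 := abs_sub_le u v (round v)
    have h4 := abs_sub_le v u (round u)
    rw [abs_sub_comm v u] at h4
    exact abs_le.2 ⟨by linarith, by linarith⟩
  obtain ⟨hl1, hl2⟩ := abs_le.1 hlip
  refine ⟨fun hu => ?_, fun hu => ?_⟩
  · have hv2 : 2 * m * |v - round v| < j := by
      refine hv'.resolve_right fun h => ?_
      nlinarith
    refine ⟨hv2, ?_⟩
    by_contra hne
    -- Different nearest integers would force 2m < 2j + 1, by passing through u and v, whereas j + 1
    -- ≤ m.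
    have h1 : (1 : ℝ) ≤ |(round u : ℝ) - round v| := by
      have : 1 ≤ |round u - round v| := Int.one_le_abs (sub_ne_zero.2 hne)
      exact_mod_cast this
    have h2 := abs_sub_le (round u : ℝ) u (round v)
    have h3 := abs_sub_le u v (round v)
    rw [abs_sub_comm _ u] at h2
    nlinarith
  · have hv2 : (j : ℝ) + 1 ≤ 2 * m * |v - round v| := by
      refine hv'.resolve_left fun h => ?_
      nlinarith
    refine ⟨hv2, ?_⟩
    -- If the floors differ, the integer ⌊b⌋ lies between a and b, so b is closer than 1/(2m) to an
    -- integer.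
    have aux : ∀ a b : ℝ, |a - b| * (2 * m) < 1 → 1 ≤ 2 * m * |b - round b| → ⌊a⌋ ≤ ⌊b⌋ →
        ⌊a⌋ = ⌊b⌋ := by
      intro a b hab hb hle
      by_contra hne
      have h1 : ⌊a⌋ + 1 ≤ ⌊b⌋ := by omega
      have h2 : (⌊b⌋ : ℝ) ≤ b := Int.floor_le b
      have h3 : a < ⌊b⌋ := Int.floor_lt.1 (by omega)
      have h4 := round_le b ⌊b⌋
      rw [abs_of_nonneg (by linarith : (0 : ℝ) ≤ b - ⌊b⌋)] at h4
      have h5 : b - a ≤ |a - b| := by rw [abs_sub_comm]; exact le_abs_self _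
      nlinarith
    have hj : (0 : ℝ) ≤ j := by positivity
    rcases le_total ⌊u⌋ ⌊v⌋ with h | h
    · exact aux u v huv (by linarith) h
    · exact (aux v u (by rwa [abs_sub_comm]) (by linarith) h).symm

theorem exists_forall_ne_of_fin {n : ℕ} (g : Fin n → ℕ) : ∃ j : Fin (n + 1), ∀ i, g i ≠ j := by
  by_contra! h
  choose i hi using h
  have hinj : Function.Injective i := fun a b hab => by
    apply Fin.ext
    rw [← hi a, ← hi b, hab]
  simpa using Fintype.card_le_of_injective i hinj

/-- After division by l, colour j forbids every coordinate a distance to ℤ in [j, j+1)/(2(n+1)).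
Each of the n coordinates rules out at most one of the n + 1 colours, so one remains. A step below s
moves a coordinate by less than the gap s/l = 1/(2(n+1)), so along a chain its nearest integer or
its floor is constant. -/
theorem scaleCovered_pi (n : ℕ) {s : ℝ} (hs : 0 < s) :
    ScaleCovered n (Set.univ : Set (Fin n → ℝ)) s (2 * (n + 1) * s) := by
  have hl : 0 < 2 * ((n : ℝ) + 1) * s := by positivity
  set l := 2 * ((n : ℝ) + 1) * s with hldef
  refine ⟨fun j => {x | ∀ i, ⌊2 * ((n + 1 : ℕ) : ℝ) * |x i / l - round (x i / l)|⌋₊ ≠ j},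
    fun x _ => ?_, fun j x hx y hxy => ?_⟩
  · exact Set.mem_iUnion.2 (exists_forall_ne_of_fin _)
  · refine (dist_pi_le_iff hl.le).2 fun i => ?_
    have key : (2 * ((n + 1 : ℕ) : ℝ) * |y i / l - round (y i / l)| < (j : ℕ) ∧
        round (x i / l) = round (y i / l)) ∨
        (((j : ℕ) : ℝ) + 1 ≤ 2 * ((n + 1 : ℕ) : ℝ) * |y i / l - round (y i / l)| ∧
          ⌊x i / l⌋ = ⌊y i / l⌋) := by
      induction hxy with
      | refl =>
        have hxi := hx i
        by_contra! h
        exact hxi ((Nat.floor_eq_iff (by positivity)).2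
          ⟨by by_contra! h'; exact h.1 h' rfl, by by_contra! h'; exact h.2 h' rfl⟩)
      | @tail y z _ hyz ih =>
        obtain ⟨-, hz, hd⟩ := hyz
        have hd' : |y i / l - z i / l| * (2 * ((n + 1 : ℕ) : ℝ)) < 1 := by
          have h1 : |y i - z i| < s := (dist_le_pi_dist y z i).trans_lt hd
          rw [← sub_div, abs_div, abs_of_pos hl, div_mul_eq_mul_div, div_lt_one hl, hldef]
          push_cast
          nlinarith [(n.cast_nonneg : (0 : ℝ) ≤ n)]
        obtain ⟨h1, h2⟩ := round_floor_step j.2 hd' (hz i)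
        rcases ih with ⟨ha, hb⟩ | ⟨ha, hb⟩
        · exact .inl ⟨(h1 ha).1, hb.trans (h1 ha).2⟩
        · exact .inr ⟨(h2 ha).1, hb.trans (h2 ha).2⟩
    have hle : |x i / l - y i / l| ≤ 1 := by
      rcases key with ⟨-, h⟩ | ⟨-, h⟩
      · have h1 := abs_sub_round (x i / l)
        have h2 := abs_sub_round (y i / l)
        have h3 := abs_sub_le (x i / l) (round (x i / l)) (y i / l)
        rw [h, abs_sub_comm (round (y i / l) : ℝ) (y i / l)] at h3
        rw [h] at h1
        linarith
      · exact (Int.abs_sub_lt_one_of_floor_eq_floor h).le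
    rwa [← sub_div, abs_div, abs_of_pos hl, div_le_one hl] at hle

/-- A uniform bound for the number of points of a separated set in a ball which embeds in
`Fin n → ℝ`. -/
theorem exists_card_le_of_separated (n : ℕ) {ε R : ℝ} (hε : 0 < ε) :
    ∃ N : ℕ, ∀ (ι : Type) [Fintype ι] (p : Fin n → ℝ) (q : ι → Fin n → ℝ),
      (∀ k, dist (q k) p ≤ R) → (∀ k l, k ≠ l → ε ≤ dist (q k) (q l)) → Fintype.card ι ≤ N := by
  -- Cells of a grid of side ε translated to p: a cell contains at most one point of an ε-separated
  -- set.
  let B : Finset (Fin n → ℤ) := Fintype.piFinset fun _ => Finset.Icc (⌊-R / ε⌋) (⌊R / ε⌋)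
  refine ⟨B.card, fun ι _ p q hq hsep => ?_⟩
  refine Finset.card_le_card_of_injOn (s := Finset.univ)
    (fun k i => ⌊(q k i - p i) / ε⌋) (fun k _ => ?_) (fun k _ l _ hkl => ?_)
  · refine Fintype.mem_piFinset.2 fun i => Finset.mem_Icc.2 ?_
    have h : |q k i - p i| ≤ R := (dist_le_pi_dist (q k) p i).trans (hq k)
    obtain ⟨h1, h2⟩ := abs_le.1 h
    exact ⟨Int.floor_le_floor (by gcongr), Int.floor_le_floor (by gcongr)⟩
  · by_contra hne
    refine (hsep k l hne).not_gt ((dist_pi_lt_iff hε).2 fun i => ?_)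
    have h := Int.abs_sub_lt_one_of_floor_eq_floor (congrFun hkl i)
    rwa [← sub_div, abs_div, abs_of_pos hε, div_lt_one hε, sub_sub_sub_cancel_right] at h

end Euclidean

/-! ### Finitely many separated families of balls, and the local-to-global step. -/

section Coloring

variable {X : Type*} [MetricSpace X]

theorem exists_maximal_separated (T : Set X) {σ : ℝ} (hσ : 0 < σ) :
    ∃ M ⊆ T, (∀ a ∈ M, ∀ b ∈ M, dist a b < σ → a = b) ∧ ∀ x ∈ T, ∃ a ∈ M, dist x a < σ := by
  obtain ⟨M, hM⟩ := zorn_subset {M : Set X | M ⊆ T ∧ ∀ a ∈ M, ∀ b ∈ M, dist a b < σ → a = b} (by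
    intro c hc hchain
    refine ⟨⋃₀ c, ⟨Set.sUnion_subset fun s hs => (hc hs).1, ?_⟩, fun s => Set.subset_sUnion_of_mem⟩
    rintro a ⟨s, hs, has⟩ b ⟨t, ht, hbt⟩ hab
    rcases hchain.total hs ht with h | h
    · exact (hc ht).2 a (h has) b hbt hab
    · exact (hc hs).2 a has b (h hbt) hab)
  refine ⟨M, hM.prop.1, hM.prop.2, fun x hx => ?_⟩
  by_contra! hfar
  have hmem : x ∈ M := by
    refine hM.le_of_ge (y := insert x M) ⟨Set.insert_subset hx hM.prop.1, ?_⟩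
      (Set.subset_insert x M) (Set.mem_insert x M)
    rintro a (rfl | ha) b (rfl | hb) hab
    · rfl
    · exact absurd hab (hfar b hb).not_gt
    · rw [dist_comm] at hab
      exact absurd hab (hfar a ha).not_gt
    · exact hM.prop.2 a ha b hb hab
  have := hfar x hmem
  rw [dist_self] at this
  linarith

/-- If separated families in balls have bounded cardinality, then the space is covered by finitely
many families of pairwise distant balls. -/
theorem exists_separated_ball_cover {ρ σ : ℝ} (hσ : 0 < σ) {N : ℕ}
    (hN : ∀ (x : X) (q : Fin (N + 1) → X), (∀ k, dist (q k) x ≤ σ) →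
      ¬ ∀ k l, k ≠ l → ρ ≤ dist (q k) (q l)) :
    ∃ A : ℕ → Set X, (∀ k, ∀ a ∈ A k, ∀ b ∈ A k, dist a b < σ → a = b) ∧
      (⋃ k < N + 1, ⋃ a ∈ A k, Metric.ball a ρ) = Set.univ := by
  choose M hMT hMs hMm using fun T : Set X => exists_maximal_separated T hσ
  -- `T k` is what the first k families miss. A point missed by all N + 1 families has a centre of
  -- each within σ, by maximality; these centres are pairwise ρ-apart, since later ones avoid
  -- earlier balls. This contradicts `hN`.
  let T : ℕ → Set X := fun k =>
    Nat.rec Set.univ (fun _ T => T \ ⋃ a ∈ M T, Metric.ball a ρ) k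
  have hT : ∀ k, T (k + 1) = T k \ ⋃ a ∈ M (T k), Metric.ball a ρ := fun k => rfl
  have hanti : Antitone T := antitone_nat_of_succ_le fun k => by
    rw [hT]
    exact Set.sdiff_subset
  refine ⟨fun k => M (T k), fun k => hMs _, Set.eq_univ_of_forall fun x => ?_⟩
  by_contra hx
  simp only [Set.mem_iUnion, exists_prop, not_exists, not_and] at hx
  have hxT : ∀ k ≤ N + 1, x ∈ T k := by
    intro k
    induction k with
    | zero => exact fun _ => Set.mem_univ x
    | succ k ih =>
      intro hk
      rw [hT]
      refine ⟨ih (by omega), ?_⟩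
      simp only [Set.mem_iUnion, exists_prop, not_exists, not_and]
      exact hx k (by omega)
  choose q hqM hqd using fun k : Fin (N + 1) => hMm (T k) x (hxT k k.2.le)
  refine hN x q (fun k => ?_) ?_
  · rw [dist_comm]
    exact (hqd k).le
  · have aux : ∀ k l : Fin (N + 1), k < l → ρ ≤ dist (q l) (q k) := by
      intro k l hkl
      have h : q l ∈ T (k + 1) := hanti (Nat.succ_le_of_lt hkl) (hMT _ (hqM l))
      rw [hT] at h
      have h2 := h.2
      simp only [Set.mem_iUnion, exists_prop, not_exists, not_and, Metric.mem_ball, not_lt] at h2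
      exact h2 _ (hqM k)
    intro k l hkl
    rcases lt_or_gt_of_ne hkl with h | h
    · rw [dist_comm]
      exact aux k l h
    · exact aux l k h

/-- A metric space all of whose balls of a fixed radius are uniformly bi-Lipschitz embedded in
`Fin n → ℝ` has capacity dimension at most `n`. -/
theorem capDimLE_of_biLipschitz_balls {n : ℕ} {r K : ℝ} (hr : 0 < r) (hK : 0 < K)
    (h : ∀ a : X, ∃ f : X → Fin n → ℝ, ∀ x ∈ Metric.ball a r, ∀ y ∈ Metric.ball a r,
      dist (f x) (f y) ≤ K * dist x y ∧ dist x y ≤ K * dist (f x) (f y)) :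
    CapDimLE X n := by
  -- The closed 3ρ-ball used for packing must lie in the open r-ball where f is bi-Lipschitz.
  obtain ⟨ρ, hρ, hρr⟩ : ∃ ρ : ℝ, 0 < ρ ∧ r = 4 * ρ := ⟨r / 4, by positivity, by ring⟩
  obtain ⟨N, hN⟩ := exists_card_le_of_separated n (ε := ρ / K) (R := K * (3 * ρ)) (by positivity)
  obtain ⟨A, hA, hcov⟩ := exists_separated_ball_cover (X := X) (ρ := ρ) (σ := 3 * ρ) (N := N)
    (by positivity) (fun x q hq hsep => by
      obtain ⟨f, hf⟩ := h x
      have hqb : ∀ k, q k ∈ Metric.ball x r := fun k => by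
        rw [Metric.mem_ball]
        linarith [hq k]
      have := hN (Fin (N + 1)) (f x) (fun k => f (q k))
        (fun k => ((hf _ (hqb k) x (Metric.mem_ball_self hr)).1).trans (by gcongr; exact hq k))
        (fun k l hkl => by
          rw [div_le_iff₀' hK]
          exact (hsep k l hkl).trans (hf _ (hqb k) _ (hqb l)).2)
      simp at this)
  refine CapDimLEOn.capDimLE ?_
  rw [← hcov]
  refine capDimLEOn_iUnion_lt (fun k => ?_) _
  refine capDimLEOn_iUnion_ball (C := K * (2 * (n + 1) * K)) (δ := 1) hρ (by positivity) one_pos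
    (hA k) fun a s hs _ => ?_
  obtain ⟨f, hf⟩ := h a
  have hball : Metric.ball a ρ ⊆ Metric.ball a r := Metric.ball_subset_ball (by linarith)
  have := ScaleCovered.preimage (n := n) (A := Metric.ball a ρ) (s := s) hK
    (fun x hx y hy => (hf x (hball hx) y (hball hy)).1)
    (fun x hx y hy => (hf x (hball hx) y (hball hy)).2)
    (scaleCovered_pi n (s := K * s) (by positivity))
  convert this using 1
  ring

end Coloring

/-! ### Left-invariance of the distance and bi-Lipschitz charts. -/

section Riemannian

open Set MeasureTheory Manifold Filter Bundle
open scoped ENNReal NNReal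

variable {E : Type*} [NormedAddCommGroup E] [NormedSpace ℝ E]
  {H : Type*} [TopologicalSpace H] (I : ModelWithCorners ℝ E H)

section LeftMul

variable {G : Type*} [Group G] [TopologicalSpace G] [ChartedSpace H G]
    [RiemannianBundle (fun x : G => TangentSpace I x)]

theorem IsLeftInvariantMetric.enorm_mfderiv (hinv : IsLeftInvariantMetric I G) (g x : G)
    (v : TangentSpace I x) :
    ‖(mfderiv I I (fun y : G => g * y) x v : TangentSpace I (g * x))‖ₑ = ‖v‖ₑ := by
  have h : ‖(mfderiv I I (fun y : G => g * y) x v : TangentSpace I (g * x))‖ = ‖v‖ := by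
    rw [norm_eq_sqrt_real_inner, norm_eq_sqrt_real_inner]
    exact congrArg Real.sqrt (hinv g x v v)
  simp only [enorm, nnnorm, h]

/-- Left translation carries a C¹ path to one of the same length, its derivative being
norm-preserving. -/
theorem IsLeftInvariantMetric.riemannianEDist_mul_left_le [LieGroup I ∞ G]
    (hinv : IsLeftInvariantMetric I G)
    (g x y : G) : riemannianEDist I (g * x) (g * y) ≤ riemannianEDist I x y := by
  have hmul : ContMDiff I I 1 (fun y : G => g * y) :=
    (contMDiff_mul_left (I := I) (n := ∞) (a := g)).of_le (by simp)
  refine le_of_forall_gt fun r hr => ?_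
  obtain ⟨γ, rfl, rfl, hγ, hlt⟩ := exists_lt_of_riemannianEDist_lt hr
  refine (riemannianEDist_le_pathELength (γ := fun t => g * γ t) (hmul.comp_contMDiffOn hγ) rfl rfl
    zero_le_one).trans_lt (lt_of_eq_of_lt ?_ hlt)
  simp only [pathELength_eq_lintegral_mfderivWithin_Icc]
  refine setLIntegral_congr_fun measurableSet_Icc fun t ht => ?_
  have hcomp : mfderivWithin 𝓘(ℝ, ℝ) I (fun t => g * γ t) (Icc 0 1) t =
      (mfderiv I I (fun y : G => g * y) (γ t)) ∘L (mfderivWithin 𝓘(ℝ, ℝ) I γ (Icc 0 1) t) := by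
    refine mfderiv_comp_mfderivWithin (I' := I) t (hmul.mdifferentiable one_ne_zero _)
      (hγ.mdifferentiableOn one_ne_zero t ht) ?_
    rw [uniqueMDiffWithinAt_iff_uniqueDiffWithinAt]
    exact uniqueDiffOn_Icc zero_lt_one t ht
  have hcomp1 : mfderivWithin 𝓘(ℝ, ℝ) I (fun t => g * γ t) (Icc 0 1) t 1 =
      (mfderiv I I (fun y : G => g * y) (γ t)) (mfderivWithin 𝓘(ℝ, ℝ) I γ (Icc 0 1) t 1) :=
    congr($hcomp 1)
  change ‖mfderivWithin 𝓘(ℝ, ℝ) I (fun t => g * γ t) (Icc 0 1) t 1‖ₑ = _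
  rw [hcomp1]
  exact hinv.enorm_mfderiv I g (γ t) _

end LeftMul

section Chart

variable {M : Type*}

attribute [local instance] normedAddCommGroupTangentSpaceVectorSpace
  normedSpaceTangentSpaceVectorSpace

/-- The inverse of the extended chart is Lipschitz near the base point. -/
theorem exists_nhds_riemannianEDist_le_mul_edist_extChartAt [TopologicalSpace M] [ChartedSpace H M]
    [RiemannianBundle (fun x : M => TangentSpace I x)] [IsManifold I 1 M]
    [IsContinuousRiemannianBundle E (fun x : M => TangentSpace I x)] (x : M) :
    ∃ C : ℝ≥0, ∃ U ∈ 𝓝 x, ∀ y ∈ U, ∀ z ∈ U,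
      riemannianEDist I y z ≤ C * edist (extChartAt I x y) (extChartAt I x z) := by
  rcases eventually_enorm_mfderivWithin_symm_extChartAt_lt I x with ⟨C, C_pos, hC⟩
  obtain ⟨V, hV, hVC⟩ := hC.exists_mem
  obtain ⟨r, r_pos, hr⟩ : ∃ r > 0,
      Metric.ball (extChartAt I x x) r ∩ range I ⊆ (extChartAt I x).target ∩ V :=
    Metric.mem_nhdsWithin_iff.1 (inter_mem (extChartAt_target_mem_nhdsWithin x) hV)
  have A : (extChartAt I x) ⁻¹' (Metric.ball (extChartAt I x x) r ∩ range I) ∈ 𝓝 x := by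
    apply extChartAt_preimage_mem_nhds_of_mem_nhdsWithin (by simp)
    rw [inter_comm]
    exact inter_mem_nhdsWithin _ (Metric.ball_mem_nhds _ r_pos)
  refine ⟨C, _, inter_mem A (chart_source_mem_nhds H x), ?_⟩
  rintro y ⟨hy, h'y⟩ z ⟨hz, h'z⟩
  let η := ContinuousAffineMap.lineMap (R := ℝ) (extChartAt I x y) (extChartAt I x z)
  set γ := (extChartAt I x).symm ∘ η
  -- Convexity of the ball and of `range I` keeps the coordinate segment where the derivative of the
  -- inverse chart is bounded; its lift is the comparison path.
  have hη : Icc 0 1 ⊆ ⇑η ⁻¹' ((extChartAt I x).target ∩ V) := by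
    simp only [← image_subset_iff, ContinuousAffineMap.coe_lineMap_eq,
     ← segment_eq_image_lineMap, η]
    exact (((convex_ball _ _).inter I.convex_range).segment_subset hy hz).trans hr
  simp only [preimage_inter, subset_inter_iff] at hη
  have η_smooth : ContMDiffOn 𝓘(ℝ, ℝ) 𝓘(ℝ, E) 1 η (Icc 0 1) := by
    apply ContMDiff.contMDiffOn
    rw [contMDiff_iff_contDiff]
    exact ContinuousAffineMap.contDiff _
  have : riemannianEDist I y z ≤ pathELength I γ 0 1 := by
    apply riemannianEDist_le_pathELength _ _ _ zero_le_one
    · exact (contMDiffOn_extChartAt_symm x).comp η_smooth hη.1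
    · simp [γ, η, ContinuousAffineMap.coe_lineMap_eq, h'y]
    · simp [γ, η, ContinuousAffineMap.coe_lineMap_eq, h'z]
  apply this.trans
  rw [← lintegral_fderiv_lineMap_eq_edist, pathELength_eq_lintegral_mfderivWithin_Icc,
    ← lintegral_const_mul' _ _ ENNReal.coe_ne_top]
  apply setLIntegral_mono' measurableSet_Icc (fun t ht ↦ ?_)
  have : mfderivWithin 𝓘(ℝ, ℝ) I γ (Icc 0 1) t =
      (mfderivWithin 𝓘(ℝ, E) I (extChartAt I x).symm (range I) (η t)) ∘L
        (mfderivWithin 𝓘(ℝ, ℝ) 𝓘(ℝ, E) η (Icc 0 1) t) := by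
    apply mfderivWithin_comp
    · exact mdifferentiableWithinAt_extChartAt_symm (hη.1 ht)
    · exact η_smooth.mdifferentiableOn one_ne_zero t ht
    · exact hη.1.trans (preimage_mono (extChartAt_target_subset_range x))
    · rw [uniqueMDiffWithinAt_iff_uniqueDiffWithinAt]
      exact uniqueDiffOn_Icc zero_lt_one t ht
  have : mfderivWithin 𝓘(ℝ, ℝ) I γ (Icc 0 1) t 1 =
      (mfderivWithin 𝓘(ℝ, E) I (extChartAt I x).symm (range I) (η t))
        (mfderivWithin 𝓘(ℝ, ℝ) 𝓘(ℝ, E) η (Icc 0 1) t 1) := congr($this 1)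
  rw [this]
  apply (ContinuousLinearMap.le_opENorm _ _).trans
  gcongr
  · exact (hVC _ (hη.2 ht)).le
  · simp only [mfderivWithin_eq_fderivWithin]
    exact le_of_eq rfl

/-- The extended chart is Lipschitz near the base point. -/
theorem exists_nhds_edist_extChartAt_le_mul_edist [PseudoEMetricSpace M] [ChartedSpace H M]
    [RiemannianBundle (fun x : M => TangentSpace I x)] [IsManifold I 1 M]
    [IsContinuousRiemannianBundle E (fun x : M => TangentSpace I x)] [IsRiemannianManifold I M]
    (x : M) :
    ∃ C : ℝ≥0, ∃ U ∈ 𝓝 x, ∀ y ∈ U, ∀ z ∈ U,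
      edist (extChartAt I x y) (extChartAt I x z) ≤ C * edist y z := by
  rcases eventually_enorm_mfderiv_extChartAt_lt I x with ⟨C, C_pos, hC⟩
  obtain ⟨r, r_pos, hr⟩ := EMetric.mem_nhds_iff.1 (inter_mem hC (chart_source_mem_nhds H x))
  -- With y within r/3 of x, a path from y of length below 2r/3 stays in the r-ball, where the
  -- derivative bound holds.
  have hr3 : 0 < r / 3 := ENNReal.div_pos r_pos.ne' (by simp)
  refine ⟨C, _, Metric.eball_mem_nhds x hr3, fun y hy z hz => ?_⟩
  rw [Metric.mem_eball] at hy hz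
  have hyz : edist y z < r / 3 + r / 3 := by
    refine (edist_triangle_right y z x).trans_lt (ENNReal.add_lt_add hy hz)
  suffices ∀ L, edist y z < L → L ≤ r / 3 + r / 3 →
      edist (extChartAt I x y) (extChartAt I x z) ≤ C * L by
    have hC0 : (C : ℝ≥0∞) ≠ 0 := by simpa using C_pos.ne'
    rw [← ENNReal.div_le_iff' hC0 ENNReal.coe_ne_top]
    refine le_of_forall_gt_imp_ge_of_dense fun L hL => ?_
    rw [ENNReal.div_le_iff' hC0 ENNReal.coe_ne_top]
    exact (this (min L (r / 3 + r / 3)) (lt_min hL hyz) (min_le_right _ _)).trans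
      (by gcongr; exact min_le_left _ _)
  intro L hL hLr
  rw [IsRiemannianManifold.out (I := I)] at hL
  obtain ⟨γ, hγ0, hγ1, γ_smooth, hγ⟩ := exists_lt_of_riemannianEDist_lt hL
  have hmem : ∀ t ∈ Icc (0 : ℝ) 1, γ t ∈ Metric.eball x r := by
    intro t ht
    have h1 : edist y (γ t) ≤ pathELength I γ 0 t := by
      rw [IsRiemannianManifold.out (I := I)]
      exact riemannianEDist_le_pathELength (γ_smooth.mono (Icc_subset_Icc_right ht.2)) hγ0 rfl ht.1
    have h2 : edist y (γ t) < r / 3 + r / 3 :=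
      (h1.trans (pathELength_mono le_rfl ht.2)).trans_lt (hγ.trans_le hLr)
    rw [Metric.mem_eball, ← ENNReal.add_thirds r]
    rw [edist_comm] at h2
    exact (edist_triangle _ y _).trans_lt (ENNReal.add_lt_add h2 hy)
  have hsrc : ∀ t ∈ Icc (0 : ℝ) 1, γ t ∈ (chartAt H x).source := fun t ht => (hr (hmem t ht)).2
  let γ' := extChartAt I x ∘ γ
  have hC' : ContMDiffOn 𝓘(ℝ, ℝ) 𝓘(ℝ, E) 1 γ' (Icc 0 1) :=
    contMDiffOn_extChartAt.comp (I' := I) (t := (chartAt H x).source) γ_smooth hsrc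
  rw [edist_comm, edist_eq_enorm_sub, ← hγ0, ← hγ1]
  calc
    ‖γ' 1 - γ' 0‖ₑ
    _ ≤ ∫⁻ t in Icc 0 1, ‖derivWithin γ' (Icc 0 1) t‖ₑ := by
      apply enorm_sub_le_lintegral_derivWithin_Icc_of_contDiffOn_Icc _ zero_le_one
      rwa [← contMDiffOn_iff_contDiffOn]
    _ = ∫⁻ t in Icc 0 1, ‖mfderivWithin 𝓘(ℝ, ℝ) 𝓘(ℝ, E) γ' (Icc 0 1) t 1‖ₑ := by
      simp_rw [← fderivWithin_derivWithin, mfderivWithin_eq_fderivWithin]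
      rfl
    _ ≤ ∫⁻ t in Icc 0 1, C * ‖mfderivWithin 𝓘(ℝ, ℝ) I γ (Icc 0 1) t 1‖ₑ := by
      apply setLIntegral_mono' measurableSet_Icc (fun t ht ↦ ?_)
      have : mfderivWithin 𝓘(ℝ, ℝ) 𝓘(ℝ, E) γ' (Icc 0 1) t =
          (mfderiv I 𝓘(ℝ, E) (extChartAt I x) (γ t)) ∘L
            (mfderivWithin 𝓘(ℝ, ℝ) I γ (Icc 0 1) t) := by
        apply mfderiv_comp_mfderivWithin
        · exact mdifferentiableAt_extChartAt (hsrc t ht)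
        · exact γ_smooth.mdifferentiableOn one_ne_zero t ht
        · rw [uniqueMDiffWithinAt_iff_uniqueDiffWithinAt]
          exact uniqueDiffOn_Icc zero_lt_one _ ht
      have : mfderivWithin 𝓘(ℝ, ℝ) 𝓘(ℝ, E) γ' (Icc 0 1) t 1 =
          (mfderiv I 𝓘(ℝ, E) (extChartAt I x) (γ t))
            (mfderivWithin 𝓘(ℝ, ℝ) I γ (Icc 0 1) t 1) :=
        congr($this 1)
      rw [this]
      apply (ContinuousLinearMap.le_opENorm _ _).trans
      gcongr
      exact (hr (hmem t ht)).1.le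
    _ = C * pathELength I γ 0 1 := by
      rw [lintegral_const_mul' _ _ ENNReal.coe_ne_top,
          pathELength_eq_lintegral_mfderivWithin_Icc]
    _ ≤ C * L := by gcongr

end Chart

end Riemannian

theorem IsLeftInvariantMetric.dist_mul_left {E : Type*} [NormedAddCommGroup E] [NormedSpace ℝ E]
    {H : Type*} [TopologicalSpace H] (I : ModelWithCorners ℝ E H)
    {G : Type*} [Group G] [MetricSpace G] [ChartedSpace H G] [LieGroup I ∞ G]
    [Bundle.RiemannianBundle (fun x : G => TangentSpace I x)] [IsRiemannianManifold I G]
    (hinv : IsLeftInvariantMetric I G) (g x y : G) : dist (g * x) (g * y) = dist x y := by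
  have hle : ∀ g x y : G, edist (g * x) (g * y) ≤ edist x y := fun g x y => by
    rw [IsRiemannianManifold.out (I := I), IsRiemannianManifold.out (I := I)]
    exact hinv.riemannianEDist_mul_left_le I g x y
  have h : edist (g * x) (g * y) = edist x y :=
    le_antisymm (hle g x y) (by simpa using hle g⁻¹ (g * x) (g * y))
  rw [dist_edist, dist_edist, h]

/-- Coordinates in a chart are bi-Lipschitz near the base point. -/
theorem exists_biLipschitz_ball {E : Type*} [NormedAddCommGroup E] [NormedSpace ℝ E]
    [FiniteDimensional ℝ E] {H : Type*} [TopologicalSpace H] (I : ModelWithCorners ℝ E H)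
    {M : Type*} [MetricSpace M] [ChartedSpace H M] [IsManifold I 1 M]
    [Bundle.RiemannianBundle (fun x : M => TangentSpace I x)]
    [IsContinuousRiemannianBundle E (fun x : M => TangentSpace I x)] [IsRiemannianManifold I M]
    (p : M) : ∃ r > 0, ∃ K > 0, ∃ f : M → Fin (Module.finrank ℝ E) → ℝ,
      ∀ x ∈ Metric.ball p r, ∀ y ∈ Metric.ball p r,
        dist (f x) (f y) ≤ K * dist x y ∧ dist x y ≤ K * dist (f x) (f y) := by
  obtain ⟨C, U, hU, hCU⟩ := exists_nhds_riemannianEDist_le_mul_edist_extChartAt I p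
  obtain ⟨C', U', hU', hCU'⟩ := exists_nhds_edist_extChartAt_le_mul_edist I p
  obtain ⟨r, hr, hrU⟩ := Metric.mem_nhds_iff.1 (Filter.inter_mem hU hU')
  have e : E ≃L[ℝ] (Fin (Module.finrank ℝ E) → ℝ) := (Module.finBasis ℝ E).equivFunL
  obtain ⟨A, hA⟩ : ∃ A, LipschitzWith A e := ⟨_, e.lipschitz⟩
  obtain ⟨B, hB⟩ : ∃ B, AntilipschitzWith B e := ⟨_, e.antilipschitz⟩
  -- One constant for both directions; the 1 makes it positive even if the Lipschitz constants
  -- vanish.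
  refine ⟨r, hr, A * C' + C * B + 1, by positivity, e ∘ extChartAt I p, fun x hx y hy => ?_⟩
  have h1 : dist x y ≤ C * dist (extChartAt I p x) (extChartAt I p y) := by
    have h := hCU x (hrU hx).1 y (hrU hy).1
    rw [← IsRiemannianManifold.out (I := I), edist_nndist, edist_nndist] at h
    exact_mod_cast h
  have h2 : dist (extChartAt I p x) (extChartAt I p y) ≤ C' * dist x y := by
    have h := hCU' x (hrU hx).2 y (hrU hy).2
    rw [edist_nndist, edist_nndist] at h
    exact_mod_cast h
  have h3 := hA.dist_le_mul (extChartAt I p x) (extChartAt I p y)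
  have h4 := hB.le_mul_dist (extChartAt I p x) (extChartAt I p y)
  simp only [Function.comp_apply]
  set u := extChartAt I p x
  set v := extChartAt I p y
  have hAC := A.coe_nonneg
  have hC := C.coe_nonneg
  have hC' := C'.coe_nonneg
  have hB' := B.coe_nonneg
  have hd : 0 ≤ dist x y := dist_nonneg
  have hd' : 0 ≤ dist (e u) (e v) := dist_nonneg
  constructor
  · calc dist (e u) (e v) ≤ A * dist u v := h3
      _ ≤ A * (C' * dist x y) := by gcongr
      _ = A * C' * dist x y := by ring
      _ ≤ (A * C' + C * B + 1) * dist x y := by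
        gcongr
        have : (0 : ℝ) ≤ C * B := by positivity
        linarith
  · calc dist x y ≤ C * dist u v := h1
      _ ≤ C * (B * dist (e u) (e v)) := by gcongr
      _ = C * B * dist (e u) (e v) := by ring
      _ ≤ (A * C' + C * B + 1) * dist (e u) (e v) := by
        gcongr
        have : (0 : ℝ) ≤ A * C' := by positivity
        linarith

theorem mainTheorem10
    {E : Type*} [NormedAddCommGroup E] [NormedSpace ℝ E] [FiniteDimensional ℝ E]
    {H : Type*} [TopologicalSpace H] (I : ModelWithCorners ℝ E H) [I.Boundaryless]
    (G : Type*) [Group G] [MetricSpace G] [ConnectedSpace G] [ChartedSpace H G]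
    [LieGroup I ∞ G]
    [Bundle.RiemannianBundle (fun x : G => TangentSpace I x)]
    [IsContMDiffRiemannianBundle I ∞ E (fun x : G => TangentSpace I x)]
    [IsRiemannianManifold I G]
    (hinv : IsLeftInvariantMetric I G) :
    CapDimLE G (Module.finrank ℝ E) := by
  have : IsManifold I 1 G := IsManifold.of_le (n := ∞) (by simp)
  have : IsContinuousRiemannianBundle E (fun x : G => TangentSpace I x) := by
    obtain ⟨g, hg, hinner⟩ :=
      IsContMDiffRiemannianBundle.exists_contMDiff (IB := I) (n := ∞) (F := E)
        (E := fun x : G => TangentSpace I x)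
    exact ⟨g, hg.continuous, hinner⟩
  obtain ⟨r, hr, K, hK, f, hf⟩ := exists_biLipschitz_ball I (1 : G)
  -- Translating by a⁻¹ moves the ball at a isometrically to the ball at 1, so r and K do not depend
  -- on a.
  refine capDimLE_of_biLipschitz_balls hr hK fun a => ⟨fun x => f (a⁻¹ * x), fun x hx y hy => ?_⟩
  have hmem : ∀ z ∈ Metric.ball a r, a⁻¹ * z ∈ Metric.ball (1 : G) r := fun z hz => by
    rw [Metric.mem_ball] at hz ⊢
    rwa [← inv_mul_cancel a, hinv.dist_mul_left I]
  rw [← hinv.dist_mul_left I a⁻¹ x y]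
  exact hf _ (hmem x hx) _ (hmem y hy)
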